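/- Let $(\Omega,\mathcal F,\mathbb P)$ be a complete probability space with a $\mathbb P$-preserving transformation $\vartheta$, and let $(X,d)$ be a compact metric space with Borel $\sigma$-algebra $\mathcal B$. Let $\mathcal E\in\mathcal F\otimes\mathcal B$ be such that all fibres $\mathcal E_\omega=\{x\in X:(\omega,x)\in\mathcal E\}$ are nonempty and compact. Let $T$ be a continuous bundle random dynamical system on $\mathcal E$, i.e. a family of maps $T_\omega:\mathcal E_\omega\to\mathcal E_{\vartheta\omega}$ such that $(\omega,x)\mapsto T_\omega x$ is measurable on $\mathcal E$ and $T_\omega$ is continuous for $\mathbb P$-almost every $\omega$. Put $T^0_\omega=\mathrm{id}$ and $T_\omega^n=T_{\vartheta^{n-1}\omega}\circ\cdots\circ T_{\vartheta\omega}\circ T_\omega$. *Mean topological dimension.* For a finite open cover $\alpha$ of a nonempty compact space $K$ put $$\mathcal D(\alpha)=\min_{\beta}\Big(-1+\sup_{x\in K}\sum_{U\in\beta}1_U(x)\Big),$$ where $\beta$ runs over the finite open covers of $K$ refining $\alpha$. For a finite open cover $\alpha$ of $X$ let $\alpha_0^{n-1}(\omega|\mathcal E)$ be the cover of $\mathcal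 E_\omega$ by the sets $\bigcap_{i=0}^{n-1}(T^i_\omega)^{-1}(A_i\cap\mathcal E_{\vartheta^i\omega})$ with $A_0,\dots,A_{n-1}\in\alpha$. Define $$\mathrm{mdim}(T,\alpha)=\lim_{n\to\infty}\frac1n\,\mathbb E\,\mathcal D\big(\alpha_0^{n-1}(\omega|\mathcal E)\big),\qquad \mathrm{mdim}(T)=\sup_\alpha\mathrm{mdim}(T,\alpha),$$ the supremum being over all finite open covers $\alpha$ of $X$. *Metric mean dimension.* For $\epsilon>0$ and $n\ge1$ let $d^\omega_{\epsilon,n}(x,y)=\max_{0\le k<n}d(T^k_\omega x,T^k_\omega y)/\epsilon$ on $\mathcal E_\omega$, and let $\mathrm{cov}(\omega,\epsilon,n)$ be the minimal cardinality of a covering of $\mathcal E_\omega$ by sets of $d^\omega_{\epsilon,n}$-diameter less than $1$. Define $$S(\omega,\epsilon)=\lim_{n\to\infty}\frac1n\log\mathrm{cov}(\omega,\epsilon,n),\qquad \mathrm{mdim}_{\mathrm M}(T)=\mathbb E\,\liminf_{1>\epsilon\to0}\frac{S(\omega,\epsilon)}{-\log\epsilon}.$$ (The limit defining $\mathrm{mdim}(T,\alpha)$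 exists, and for each $\epsilon>0$ the limit defining $S(\omega,\epsilon)$ exists for almost every $\omega$. Both limits may be read as limits superior.) **Theorem.** For every continuous bundle random dynamical system $T$ as above, $$\mathrm{mdim}(T)\le\mathrm{mdim}_{\mathrm M}(T)\qquad\text{in }[0,\infty].$$ -/

import Mathlib

open MeasureTheory Filter Topology
open scoped ENNReal

noncomputable section

/-- `α` is a finite open cover of the topological space `Y`. -/
def IsFiniteOpenCover {Y : Type*} [TopologicalSpace Y] (α : Set (Set Y)) : Prop :=
  α.Finite ∧ (∀ U ∈ α, IsOpen U) ∧ ⋃₀ α = Set.univ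

/-- The cover `β` refines the cover `α`. -/
def CoverRefines {Y : Type*} (β α : Set (Set Y)) : Prop :=
  ∀ U ∈ β, ∃ V ∈ α, U ⊆ V

/-- The order `-1 + sup_y ∑_{U ∈ β} 1_U(y)` of a family of sets.  For a cover of a nonempty space
the supremum is at least `1`, so that the subtraction is not truncated. -/
def coverOrd {Y : Type*} (β : Set (Set Y)) : ℕ∞ :=
  (⨆ y : Y, {U ∈ β | y ∈ U}.encard) - 1

/-- `𝒟(α)`: the least order of a finite open cover of `Y` that refines `α`. -/
def coverDim {Y : Type*} [TopologicalSpace Y] (α : Set (Set Y)) : ℕ∞ :=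
  ⨅ (β : Set (Set Y)) (_ : IsFiniteOpenCover β ∧ CoverRefines β α), coverOrd β

/-- A continuous bundle random dynamical system over `(Ω, P)` with state space `X`. -/
structure BundleRDS {Ω : Type*} [MeasurableSpace Ω] (P : Measure Ω)
    (X : Type*) [TopologicalSpace X] [MeasurableSpace X] where
  /-- The measure preserving transformation of the base. -/
  shift : Ω → Ω
  measurePreserving_shift : MeasurePreserving shift P P
  /-- The bundle. -/
  bundle : Set (Ω × X)
  measurableSet_bundle : MeasurableSet bundle
  nonempty_fiber : ∀ ω, {x : X | (ω, x) ∈ bundle}.Nonempty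
  isCompact_fiber : ∀ ω, IsCompact {x : X | (ω, x) ∈ bundle}
  /-- The fibre maps. -/
  map : ∀ ω, {x : X | (ω, x) ∈ bundle} → {x : X | (shift ω, x) ∈ bundle}
  measurable_map : Measurable fun p : bundle => (map p.1.1 ⟨p.1.2, p.2⟩ : X)
  continuous_map : ∀ᵐ ω ∂P, Continuous (map ω)

namespace BundleRDS

section Topological

variable {Ω : Type*} [MeasurableSpace Ω] {P : Measure Ω}
  {X : Type*} [TopologicalSpace X] [MeasurableSpace X]

/-- The fibre of the bundle over `ω`. -/
abbrev fiber (R : BundleRDS P X) (ω : Ω) : Set X := {x : X | (ω, x) ∈ R.bundle}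

/-- The `n`-fold composition of the fibre maps along the orbit of `ω`, from the fibre over `ω`
to the fibre over the `n`-th iterate of `ω`. -/
def iter (R : BundleRDS P X) : (n : ℕ) → (ω : Ω) → R.fiber ω → R.fiber (R.shift^[n] ω)
  | 0, _, x => x
  | n + 1, ω, x => R.iter n (R.shift ω) (R.map ω x)

/-- The cover of the fibre over `ω` by all sets `⋂_{i < n} (T^i_ω)⁻¹ (A_i ∩ ℰ_{ϑ^i ω})` with
`A_0, …, A_{n-1} ∈ α`. -/
def joinedCover (R : BundleRDS P X) (α : Set (Set X)) (n : ℕ) (ω : Ω) : Set (Set (R.fiber ω)) :=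
  {W | ∃ A : Fin n → Set X, (∀ i, A i ∈ α) ∧
    W = ⋂ i : Fin n, {x : R.fiber ω | (R.iter i ω x : X) ∈ A i}}

/-- The mean topological dimension relative to `α`: the limit of `(1/n) 𝔼 𝒟(α_0^{n-1}(ω|ℰ))`.
The limit exists by subadditivity; it is written as a limit superior. -/
def mdimCover (R : BundleRDS P X) (α : Set (Set X)) : ℝ≥0∞ :=
  limsup (fun n : ℕ => (∫⁻ ω, (coverDim (R.joinedCover α n ω) : ℝ≥0∞) ∂P) / (n : ℝ≥0∞)) atTop

/-- The mean topological dimension. -/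
def mdim (R : BundleRDS P X) : ℝ≥0∞ :=
  ⨆ (α : Set (Set X)) (_ : IsFiniteOpenCover α), R.mdimCover α

end Topological

section Metric

variable {Ω : Type*} [MeasurableSpace Ω] {P : Measure Ω}
  {X : Type*} [MetricSpace X] [MeasurableSpace X]

/-- The metric `max_{k < n} d(T^k_ω x, T^k_ω y) / ε(ϑ^k ω)` on the fibre over `ω`. -/
def fiberDist (R : BundleRDS P X) (ε : Ω → ℝ) (n : ℕ) (ω : Ω) (x y : R.fiber ω) : ℝ≥0∞ :=
  ⨆ k : Fin n, edist (R.iter k ω x : X) (R.iter k ω y : X) / ENNReal.ofReal (ε (R.shift^[k] ω))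

/-- The diameter of a subset of the fibre over `ω` for the metric `fiberDist`. -/
def fiberDiam (R : BundleRDS P X) (ε : Ω → ℝ) (n : ℕ) (ω : Ω) (A : Set (R.fiber ω)) : ℝ≥0∞ :=
  ⨆ x ∈ A, ⨆ y ∈ A, R.fiberDist ε n ω x y

/-- The minimal cardinality of a covering of the fibre over `ω` by sets of `fiberDist`-diameter
less than `1`. -/
def cov (R : BundleRDS P X) (ε : Ω → ℝ) (n : ℕ) (ω : Ω) : ℕ∞ :=
  ⨅ (c : Set (Set (R.fiber ω))) (_ : ⋃₀ c = Set.univ ∧ ∀ A ∈ c, R.fiberDiam ε n ω A < 1), c.encard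

/-- `S(ω, ε) = lim_n (1/n) log cov(ω, ε, n)`.  The limit exists for almost every `ω`; it is written
as a limit superior.  Fibres are nonempty, so `cov ≥ 1` and the logarithm is nonnegative. -/
def covGrowth (R : BundleRDS P X) (ω : Ω) (ε : Ω → ℝ) : ℝ≥0∞ :=
  limsup (fun n : ℕ => (ENNReal.log (R.cov ε n ω : ℝ≥0∞)).toENNReal / (n : ℝ≥0∞)) atTop

/-- The metric mean dimension on the fibre over `ω`: the limit inferior of
`S(ω, ε) / (-log ε)` as the constant `ε` decreases to `0`. -/
def mdimMFiber (R : BundleRDS P X) (ω : Ω) : ℝ≥0∞ :=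
  liminf (fun ε : ℝ => R.covGrowth ω (fun _ => ε) / ENNReal.ofReal (-Real.log ε)) (𝓝[>] 0)

/-- The metric mean dimension. -/
def mdimM (R : BundleRDS P X) : ℝ≥0∞ :=
  ∫⁻ ω, R.mdimMFiber ω ∂P

end Metric

end BundleRDS

end

/-!
The inequality holds fibre by fibre: for almost every `ω`,
`limsup_n 𝒟(α_0^{n-1}(ω|ℰ)) / n ≤ liminf_ε S(ω, ε) / (-log ε)`
(`BundleRDS.limsup_coverDim_div_le_mdimMFiber`), by the argument of Lindenstrauss and Weiss.

For a finite open cover `α` of `X` take Lipschitz functions `φ A` (`A ∈ α`) with values in `[0, 1]`,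
vanishing off `A`, one of which equals `1` at each given point (`exists_lipschitz_subordinate`).
A subset of a fibre on which every `φ A ∘ T^k`, `k < n`, avoids `0` or avoids `1` lies in an element
of the joined cover (`BundleRDS.exists_subset_of_mem_joinedCover`).  Suppose a level `ξ j ∈ (0, 1)`
is chosen for each pair `j = (k, A)` in such a way that no point of the fibre is within `η` of more
than `m` of its levels.  Then the fibre is decomposed into cells (`bandCell`), the preimages of open
neighbourhoods of the faces of dimension at most `m` of a cube; two different cells of the same
dimension are disjoint, and so the order of this cover is at most `m`
(`coverDim_le_of_card_band_le`).

Such levels exist when the fibre has few pieces of small diameter.  If `D` exceeds the limit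
inferior, then for suitable small `ε` and all large `n` the fibre is covered by `ε ^ (-D n)` sets on
which every `φ A ∘ T^k` oscillates by at most `L ε`.  With levels from a grid of about `1 / (L ε)`
points, each of these sets is close to at most one level for each `j`, and a first moment estimate
(`exists_forall_card_le`) gives a choice of levels with `m ≤ b n`, for any `b > D`, once `ε` is
small.

Since `𝒟(α_0^{n-1}(ω|ℰ)) ≤ n |α|`, the reverse Fatou lemma integrates the pointwise inequality.
-/

/-! ### Covers of small order from level bands -/

/-- A cell of the decomposition of `K` cut out by the level sets `{u j = 0}`: the indices in `S` are
those for which the point is close to the level set, strictly closer than for any other index, and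
`P` records on which side of the remaining level sets the point lies.  Only `P \ S` matters. -/
def bandCell {K J : Type*} (u : J → K → ℝ) (η : ℝ) (S P : Finset J) : Set K :=
  {x | (∀ j ∈ S, |u j x| < η ∧ ∀ l ∉ S, |u j x| < |u l x|) ∧
    ∀ l ∉ S, (l ∈ P → 0 < u l x) ∧ (l ∉ P → u l x < 0)}

lemma isOpen_bandCell {K J : Type*} [TopologicalSpace K] [Finite J] {u : J → K → ℝ}
    (hu : ∀ j, Continuous (u j)) (η : ℝ) (S P : Finset J) : IsOpen (bandCell u η S P) := by
  have h : bandCell u η S P =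
      (⋂ j, ⋂ (_ : j ∈ S), ({x | |u j x| < η} ∩ ⋂ l, ⋂ (_ : l ∉ S), {x | |u j x| < |u l x|})) ∩
        ⋂ l, ⋂ (_ : l ∉ S), ((⋂ (_ : l ∈ P), {x | 0 < u l x}) ∩
          ⋂ (_ : l ∉ P), {x | u l x < 0}) := by
    ext x
    simp [bandCell]
  rw [h]
  refine IsOpen.inter (isOpen_iInter_of_finite fun j => isOpen_iInter_of_finite fun _ =>
    IsOpen.inter (isOpen_lt (hu j).abs continuous_const) (isOpen_iInter_of_finite fun l =>
      isOpen_iInter_of_finite fun _ => isOpen_lt (hu j).abs (hu l).abs))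
    (isOpen_iInter_of_finite fun l => isOpen_iInter_of_finite fun _ => IsOpen.inter
      (isOpen_iInter_of_finite fun _ => isOpen_lt continuous_const (hu l))
      (isOpen_iInter_of_finite fun _ => isOpen_lt (hu l) continuous_const))

/-- Cells of the same dimension that meet are equal. -/
lemma bandCell_eq_of_mem {K J : Type*} {u : J → K → ℝ} {η : ℝ} {S P S' P' : Finset J} {x : K}
    (hx : x ∈ bandCell u η S P) (hx' : x ∈ bandCell u η S' P') (hc : S.card = S'.card) :
    bandCell u η S P = bandCell u η S' P' := by
  have hS : S = S' := by
    by_contra hne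
    obtain ⟨j, hj, hj'⟩ := Finset.not_subset.1 fun h => hne (Finset.eq_of_subset_of_card_le h hc.ge)
    obtain ⟨l, hl', hl⟩ := Finset.not_subset.1 fun h =>
      hne (Finset.eq_of_subset_of_card_le h hc.le).symm
    exact lt_asymm ((hx.1 j hj).2 l hl) ((hx'.1 l hl').2 j hj')
  subst hS
  have hP : ∀ l ∉ S, (l ∈ P ↔ l ∈ P') := fun l hl => by
    have h1 := hx.2 l hl
    have h2 := hx'.2 l hl
    constructor
    · intro h
      by_contra h'
      exact lt_asymm (h1.1 h) (h2.2 h')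
    · intro h
      by_contra h'
      exact lt_asymm (h2.1 h) (h1.2 h')
  ext y
  simp only [bandCell, Set.mem_ofPred_eq]
  refine and_congr_right fun _ => forall₂_congr fun l hl => ?_
  rw [hP l hl]

open scoped Classical in
/-- If every point is within `η` of its prescribed level for at most `m` of the functions `f j`, the
cells of dimension at most `m` form an open cover of order at most `m`, because a point lies in at
most one cell of each dimension.  On each cell every `f j` stays above `ξ j - η` or below `ξ j`. -/
lemma coverDim_le_of_card_band_le {K J : Type*} [TopologicalSpace K] [Fintype J] {f : J → K → ℝ}
    (hf : ∀ j, Continuous (f j)) (ξ : J → ℝ) {η : ℝ} (hη : 0 < η) {m : ℕ}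
    (hm : ∀ x, (Finset.univ.filter fun j => |f j x - ξ j| < η).card ≤ m) {γ : Set (Set K)}
    (hγ : ∀ W : Set K, (∀ j, (∀ x ∈ W, ξ j - η < f j x) ∨ ∀ x ∈ W, f j x < ξ j) →
      ∃ V ∈ γ, W ⊆ V) :
    coverDim γ ≤ m := by
  set u : J → K → ℝ := fun j x => f j x - ξ j with hu
  have huc : ∀ j, Continuous (u j) := fun j => (hf j).sub continuous_const
  set β : Set (Set K) :=
    (fun p : Finset J × Finset J => bandCell u η p.1 p.2) '' {p | p.1.card ≤ m} with hβ
  have hcov : IsFiniteOpenCover β := by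
    refine ⟨(Set.toFinite _).image _, ?_, ?_⟩
    · rintro _ ⟨p, -, rfl⟩
      exact isOpen_bandCell huc _ _ _
    · refine Set.eq_univ_of_forall fun x => ⟨_, ⟨(Finset.univ.filter fun j => |f j x - ξ j| < η,
        Finset.univ.filter fun j => 0 < u j x), hm x, rfl⟩, ?_⟩
      simp only [bandCell, Set.mem_ofPred_eq, Finset.mem_filter, Finset.mem_univ, true_and, not_lt]
      refine ⟨fun j hj => ⟨hj, fun l hl => lt_of_lt_of_le hj hl⟩, fun l hl => ⟨id, fun h => ?_⟩⟩
      refine lt_of_le_of_ne h fun h0 => ?_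
      have : |u l x| = 0 := by rw [h0, abs_zero]
      exact absurd (hl.trans_eq this) (not_le.2 hη)
  have href : CoverRefines β γ := by
    rintro _ ⟨⟨S, P⟩, -, rfl⟩
    refine hγ _ fun j => ?_
    by_cases hS : j ∈ S
    · left
      intro x hx
      have := (abs_lt.1 (hx.1 j hS).1).1
      simp only [hu] at this
      linarith
    · by_cases hP : j ∈ P
      · left
        intro x hx
        have := (hx.2 j hS).1 hP
        simp only [hu] at this
        linarith
      · right
        intro x hx
        have := (hx.2 j hS).2 hP
        simp only [hu] at this
        linarith
  refine (iInf₂_le β ⟨hcov, href⟩).trans ?_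
  refine tsub_le_iff_right.2 (iSup_le fun x => ?_)
  have hex : ∀ U ∈ {U ∈ β | x ∈ U}, ∃ p : Finset J × Finset J,
      p.1.card ≤ m ∧ bandCell u η p.1 p.2 = U := fun U hU => hU.1
  choose! p hp using hex
  have hle := Set.encard_le_encard_of_injOn (s := {U ∈ β | x ∈ U})
    (t := (Finset.range (m + 1) : Set ℕ)) (f := fun U => (p U).1.card)
    (fun U hU => by
      have := (hp U hU).1
      simp only [Finset.coe_range, Set.mem_Iio]
      omega)
    (fun U hU V hV hUV => by
      rw [← (hp U hU).2, ← (hp V hV).2]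
      refine bandCell_eq_of_mem (x := x) ?_ ?_ hUV
      · rw [(hp U hU).2]
        exact hU.2
      · rw [(hp V hV).2]
        exact hV.2)
  rw [Set.encard_coe_eq_coe_finsetCard, Finset.card_range] at hle
  exact_mod_cast hle

/-! ### Choosing the levels -/

open scoped Classical in
/-- A first moment bound: among the functions `p : J → Q` there is one that hits each of the few
partial functions `b a` in at most `m` places. -/
lemma exists_forall_card_le {A J Q : Type*} [Fintype J] [Fintype Q] (C : Finset A)
    {b : A → J → Set Q} (hb : ∀ a ∈ C, ∀ j, (b a j).Subsingleton) {m : ℕ}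
    (h : C.card * 2 ^ Fintype.card J < Fintype.card Q ^ (m + 1)) :
    ∃ p : J → Q, ∀ a ∈ C, (Finset.univ.filter fun j => p j ∈ b a j).card ≤ m := by
  by_contra! hcon
  set M := Fintype.card Q with hM
  have hM0 : 0 < M := by
    rcases Nat.eq_zero_or_pos M with h0 | h0
    · simp [h0] at h
    · exact h0
  have hsum : ∀ a ∈ C, ∀ j, ∑ q : Q, (if q ∈ b a j then M else 1) ≤ 2 * M := by
    intro a ha j
    have hcard : (Finset.univ.filter fun q => q ∈ b a j).card ≤ 1 :=
      Finset.card_le_one.2 fun q hq r hr =>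
        hb a ha j (Finset.mem_filter.1 hq).2 (Finset.mem_filter.1 hr).2
    calc ∑ q : Q, (if q ∈ b a j then M else 1)
        ≤ ∑ q : Q, ((if q ∈ b a j then M else 0) + 1) :=
          Finset.sum_le_sum fun q _ => by split_ifs <;> omega
      _ = (Finset.univ.filter fun q => q ∈ b a j).card * M + M := by
          rw [Finset.sum_add_distrib, ← Finset.sum_filter]
          simp [hM]
      _ ≤ 2 * M := by nlinarith
  have key : M ^ Fintype.card J * M ^ (m + 1) ≤ M ^ Fintype.card J * (C.card * 2 ^ Fintype.card J) :=
    calc M ^ Fintype.card J * M ^ (m + 1) = ∑ _p : J → Q, M ^ (m + 1) := by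
          simp [hM]
      _ ≤ ∑ p : J → Q, ∑ a ∈ C, ∏ j, (if p j ∈ b a j then M else 1) := by
          refine Finset.sum_le_sum fun p _ => ?_
          obtain ⟨a, ha, hma⟩ := hcon p
          refine le_trans ?_ (Finset.single_le_sum (f := fun a => ∏ j, (if p j ∈ b a j then M else 1))
            (fun _ _ => Nat.zero_le _) ha)
          simp only [Finset.prod_ite, Finset.prod_const, one_pow, mul_one]
          exact Nat.pow_le_pow_right hM0 hma
      _ = ∑ a ∈ C, ∏ j, ∑ q : Q, (if q ∈ b a j then M else 1) := by
          rw [Finset.sum_comm]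
          refine Finset.sum_congr rfl fun a _ => ?_
          rw [Finset.prod_univ_sum, Fintype.piFinset_univ]
      _ ≤ ∑ a ∈ C, (2 * M) ^ Fintype.card J := by
          refine Finset.sum_le_sum fun a ha => ?_
          refine (Finset.prod_le_prod' fun j _ => hsum a ha j).trans ?_
          simp
      _ = M ^ Fintype.card J * (C.card * 2 ^ Fintype.card J) := by
          rw [Finset.sum_const, smul_eq_mul, mul_pow]
          ring
  exact absurd (Nat.le_of_mul_le_mul_left key (pow_pos hM0 _)) (not_le.2 h)

/-- A space covered by few sets on which the functions `f j` oscillate little has small dimension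
relative to any cover refined by the sets on which every `f j` avoids `0` or `1`: the levels are
taken from a grid with `M` points so spaced that a set of the cover is close to at most one of them
for each `j`. -/
lemma coverDim_le_of_oscillation_le {K J : Type*} [TopologicalSpace K] [Fintype J] {f : J → K → ℝ}
    (hf : ∀ j, Continuous (f j)) {c : Finset (Set K)} (hc : ⋃₀ (c : Set (Set K)) = Set.univ)
    {δ : ℝ} (hδ : 0 < δ) (hosc : ∀ A ∈ c, ∀ x ∈ A, ∀ y ∈ A, ∀ j, |f j x - f j y| ≤ δ)
    {M m : ℕ} (hM : M * (3 * δ) ≤ 1) (h : c.card * 2 ^ Fintype.card J < M ^ (m + 1))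
    {γ : Set (Set K)}
    (hγ : ∀ W : Set K, (∀ j, (∀ x ∈ W, 0 < f j x) ∨ ∀ x ∈ W, f j x < 1) → ∃ V ∈ γ, W ⊆ V) :
    coverDim γ ≤ m := by
  classical
  set g : Fin M → ℝ := fun q => ((q : ℕ) + 1 : ℝ) * (3 * δ) with hg
  obtain ⟨p, hp⟩ := exists_forall_card_le (Q := Fin M) c
    (b := fun A j => {q | ∃ x ∈ A, |f j x - g q| < δ}) (m := m) (by
      rintro A hA j q ⟨x, hx, hq⟩ r ⟨y, hy, hr⟩
      have ho := abs_le.1 (hosc A hA x hx y hy j)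
      have h1 := abs_lt.1 hq
      have h2 := abs_lt.1 hr
      simp only [hg] at h1 h2
      have a1 : ((q : ℕ) : ℝ) < (r : ℕ) + 1 := by
        refine lt_of_mul_lt_mul_right (a := 3 * δ) ?_ (by positivity)
        linarith
      have a2 : ((r : ℕ) : ℝ) < (q : ℕ) + 1 := by
        refine lt_of_mul_lt_mul_right (a := 3 * δ) ?_ (by positivity)
        linarith
      have b1 : (q : ℕ) < (r : ℕ) + 1 := by exact_mod_cast a1
      have b2 : (r : ℕ) < (q : ℕ) + 1 := by exact_mod_cast a2
      exact Fin.ext (by omega)) (by simpa using h)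
  refine coverDim_le_of_card_band_le hf (fun j => g (p j)) hδ (m := m) (fun x => ?_) fun W hW => ?_
  · obtain ⟨A, hA, hxA⟩ : x ∈ ⋃₀ (c : Set (Set K)) := hc ▸ Set.mem_univ x
    refine le_trans (Finset.card_le_card fun j hj => ?_) (hp A hA)
    simp only [Finset.mem_filter, Finset.mem_univ, true_and, Set.mem_ofPred_eq] at hj ⊢
    exact ⟨x, hxA, hj⟩
  · refine hγ W fun j => ?_
    have hle : g (p j) ≤ 1 := by
      refine le_trans (mul_le_mul_of_nonneg_right ?_ (by positivity)) hM
      exact_mod_cast (p j).2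
    have hge : δ ≤ g (p j) := by
      have : (0 : ℝ) ≤ ((p j : ℕ) : ℝ) * (3 * δ) := by positivity
      simp only [hg]
      linarith
    exact (hW j).imp (fun h x hx => by linarith [h x hx]) fun h x hx => by linarith [h x hx]

/-! ### Lipschitz functions subordinate to a finite open cover -/

/-- Thickened indicators of the sets `{x | ball x δ ⊆ A}`, where `δ` is a Lebesgue number of the
cover. -/
lemma exists_lipschitz_subordinate {X : Type*} [MetricSpace X] [CompactSpace X] {α : Set (Set X)}
    (hα : IsFiniteOpenCover α) :
    ∃ (L : ℝ) (φ : Set X → X → ℝ), 0 < L ∧ (∀ A x y, |φ A x - φ A y| ≤ L * dist x y) ∧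
      (∀ x, ∃ A ∈ α, φ A x = 1) ∧ ∀ A x, 0 < φ A x → x ∈ A := by
  obtain ⟨δ, hδ, h⟩ := lebesgue_number_lemma_of_metric_sUnion isCompact_univ hα.2.1 hα.2.2.ge
  refine ⟨δ⁻¹, fun A x => thickenedIndicator hδ {y | Metric.ball y δ ⊆ A} x, inv_pos.2 hδ,
    fun A x y => ?_, fun x => ?_, fun A x hx => ?_⟩
  · have := (lipschitzWith_thickenedIndicator hδ {y | Metric.ball y δ ⊆ A}).dist_le_mul x y
    rw [NNReal.dist_eq] at this
    simpa [hδ.le] using this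
  · obtain ⟨A, hA, hxA⟩ := h x (Set.mem_univ x)
    refine ⟨A, hA, ?_⟩
    exact congrArg NNReal.toReal
      (thickenedIndicator_one hδ {y | Metric.ball y δ ⊆ A} (x := x) hxA)
  · by_contra hxA
    have hmem : x ∉ Metric.thickening δ {y | Metric.ball y δ ⊆ A} := fun hmem => by
      obtain ⟨y, hy, hxy⟩ := Metric.mem_thickening_iff.1 hmem
      exact hxA (hy hxy)
    exact hx.ne' (congrArg NNReal.toReal (thickenedIndicator_zero hδ _ hmem))

namespace BundleRDS

/-! ### Iterated fibre maps and joined covers -/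

section Topological

variable {Ω : Type*} [MeasurableSpace Ω] {P : Measure Ω}
  {X : Type*} [TopologicalSpace X] [MeasurableSpace X]

lemma continuous_iter (R : BundleRDS P X) (n : ℕ) (ω : Ω)
    (h : ∀ k, Continuous (R.map (R.shift^[k] ω))) : Continuous (R.iter n ω) := by
  induction n generalizing ω with
  | zero => exact continuous_id
  | succ n ih => exact (ih (R.shift ω) fun k => h (k + 1)).comp (h 0)

lemma ae_continuous_iter (R : BundleRDS P X) : ∀ᵐ ω ∂P, ∀ n, Continuous (R.iter n ω) := by
  have h : ∀ᵐ ω ∂P, ∀ k, Continuous (R.map (R.shift^[k] ω)) := ae_all_iff.2 fun k =>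
    (R.measurePreserving_shift.iterate k).quasiMeasurePreserving.ae R.continuous_map
  filter_upwards [h] with ω hω n using R.continuous_iter n ω hω

/-- If the functions `φ A` are subordinate to `α` and at each point one of them equals `1`, then a
set on which each `φ A ∘ T^k` is either positive or less than `1` lies in an element of the joined
cover: were every `φ A ∘ T^k` less than `1` for a given `k`, the set would be empty. -/
lemma exists_subset_of_mem_joinedCover (R : BundleRDS P X) {α : Set (Set X)} {φ : Set X → X → ℝ}
    (h1 : ∀ x, ∃ A ∈ α, φ A x = 1) (h0 : ∀ A x, 0 < φ A x → x ∈ A) {n : ℕ} {ω : Ω}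
    {W : Set (R.fiber ω)}
    (hW : ∀ j : Fin n × α, (∀ x ∈ W, 0 < φ j.2 (R.iter j.1 ω x)) ∨
      ∀ x ∈ W, φ j.2 (R.iter j.1 ω x) < 1) :
    ∃ V ∈ R.joinedCover α n ω, W ⊆ V := by
  have h : ∀ k : Fin n, ∃ A ∈ α, ∀ x ∈ W, 0 < φ A (R.iter k ω x) := by
    intro k
    by_contra! hcon
    have hlt : ∀ A ∈ α, ∀ x ∈ W, φ A (R.iter k ω x) < 1 := by
      intro A hA
      refine (hW (k, ⟨A, hA⟩)).resolve_left fun hpos => ?_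
      obtain ⟨x, hx, hle⟩ := hcon A hA
      exact absurd (hpos x hx) (not_lt.2 hle)
    obtain ⟨z, -⟩ := R.nonempty_fiber ω
    obtain ⟨A, hA, -⟩ := h1 z
    obtain ⟨x, hx, -⟩ := hcon A hA
    obtain ⟨B, hB, hB1⟩ := h1 (R.iter k ω x)
    exact (hlt B hB x hx).ne hB1
  choose A hA hpos using h
  exact ⟨_, ⟨A, hA, rfl⟩, fun x hx => Set.mem_iInter.2 fun k => h0 _ _ (hpos k x hx)⟩

end Topological

section Metric

variable {Ω : Type*} [MeasurableSpace Ω] {P : Measure Ω}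
  {X : Type*} [MetricSpace X] [MeasurableSpace X]

lemma coverDim_joinedCover_le [CompactSpace X] (R : BundleRDS P X) {α : Set (Set X)}
    (hα : IsFiniteOpenCover α) {ω : Ω} (hω : ∀ n, Continuous (R.iter n ω)) (n : ℕ) :
    coverDim (R.joinedCover α n ω) ≤ (n * α.ncard : ℕ) := by
  classical
  obtain ⟨L, φ, hL, hlip, h1, h0⟩ := exists_lipschitz_subordinate hα
  have := hα.1.fintype
  have hφ : ∀ A, Continuous (φ A) := fun A =>
    (LipschitzWith.of_dist_le_mul (K := ⟨L, hL.le⟩) fun x y => hlip A x y).continuous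
  refine coverDim_le_of_card_band_le (J := Fin n × α) (f := fun j x => φ j.2 (R.iter j.1 ω x))
    (fun j => (hφ _).comp (continuous_subtype_val.comp (hω _))) (fun _ => 1 / 2) (η := 1 / 2)
    (by norm_num) (fun x => ?_) fun W hW => ?_
  · refine (Finset.card_le_univ _).trans_eq ?_
    rw [Fintype.card_prod, Fintype.card_fin, Set.ncard_eq_toFinset_card', Set.toFinset_card]
  · refine R.exists_subset_of_mem_joinedCover h1 h0 fun j => (hW j).imp
      (fun h x hx => ?_) fun h x hx => ?_
    · have := h x hx
      linarith
    · have := h x hx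
      linarith

lemma exists_finset_cover_of_log_cov_lt (R : BundleRDS P X) {ε : Ω → ℝ} {n : ℕ} {ω : Ω} {t : ℝ}
    (h : (ENNReal.log (R.cov ε n ω : ℝ≥0∞)).toENNReal < ENNReal.ofReal t) :
    ∃ c : Finset (Set (R.fiber ω)), ⋃₀ (c : Set (Set (R.fiber ω))) = Set.univ ∧
      (∀ A ∈ c, R.fiberDiam ε n ω A < 1) ∧ (c.card : ℝ) ≤ Real.exp t := by
  obtain hk | ⟨k, hk⟩ : R.cov ε n ω = ⊤ ∨ ∃ k : ℕ, R.cov ε n ω = k := by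
    cases R.cov ε n ω with
    | top => exact Or.inl rfl
    | coe k => exact Or.inr ⟨k, rfl⟩
  · simp [hk] at h
  · have hlt : R.cov ε n ω < (k + 1 : ℕ) := by
      rw [hk]
      exact_mod_cast Nat.lt_succ_self k
    simp only [cov, iInf_lt_iff] at hlt
    obtain ⟨c, ⟨hc, hdiam⟩, hcard⟩ := hlt
    have hfin : c.Finite := Set.encard_lt_top_iff.1 (hcard.trans (ENat.natCast_lt_top _))
    refine ⟨hfin.toFinset, by simpa using hc, by simpa using hdiam, ?_⟩
    rw [hfin.encard_eq_coe_toFinset_card] at hcard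
    have hck : hfin.toFinset.card ≤ k := Nat.lt_succ_iff.1 (by exact_mod_cast hcard)
    have hkt : (k : ℝ) ≤ Real.exp t := by
      rcases Nat.eq_zero_or_pos k with rfl | hk0
      · simpa using (Real.exp_pos t).le
      · have hk0' : (0 : ℝ) < k := by exact_mod_cast hk0
        rw [hk, ENat.toENNReal_coe, ENNReal.log_pos_real (by exact_mod_cast hk0.ne')
          (ENNReal.natCast_ne_top k), EReal.toENNReal_of_ne_top (EReal.coe_ne_top _)] at h
        have h' := (ENNReal.ofReal_lt_ofReal_iff').1 h |>.1
        simp only [EReal.toReal_coe, ENNReal.toReal_natCast] at h'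
        rw [← Real.log_le_iff_le_exp hk0']
        exact h'.le
    exact le_trans (by exact_mod_cast hck) hkt

lemma dist_iter_lt_of_fiberDiam_lt_one (R : BundleRDS P X) {ε : ℝ} (hε : 0 < ε) {n : ℕ} {ω : Ω}
    {A : Set (R.fiber ω)} (hA : R.fiberDiam (fun _ => ε) n ω A < 1) {x y : R.fiber ω}
    (hx : x ∈ A) (hy : y ∈ A) (k : Fin n) :
    dist (R.iter k ω x : X) (R.iter k ω y : X) < ε := by
  have h : edist (R.iter k ω x : X) (R.iter k ω y : X) / ENNReal.ofReal ε < 1 := by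
    refine lt_of_le_of_lt (le_trans ?_ (le_iSup₂_of_le x hx (le_iSup₂_of_le y hy le_rfl))) hA
    exact le_iSup (fun k : Fin n => edist (R.iter k ω x : X) (R.iter k ω y : X) /
      ENNReal.ofReal ε) k
  rw [ENNReal.div_lt_iff (Or.inl (by simpa using hε)) (Or.inl ENNReal.ofReal_ne_top), one_mul,
    edist_lt_ofReal] at h
  exact h

/-! ### The pointwise inequality -/

/-- The comparison of the two dimensions on a single fibre. -/
lemma limsup_coverDim_div_le_mdimMFiber [CompactSpace X] (R : BundleRDS P X) {α : Set (Set X)}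
    (hα : IsFiniteOpenCover α) {ω : Ω} (hω : ∀ n, Continuous (R.iter n ω)) :
    limsup (fun n : ℕ => (coverDim (R.joinedCover α n ω) : ℝ≥0∞) / (n : ℝ≥0∞)) atTop
      ≤ R.mdimMFiber ω := by
  classical
  obtain ⟨L, φ, hL, hlip, h1, h0⟩ := exists_lipschitz_subordinate hα
  have := hα.1.fintype
  have hφ : ∀ A, Continuous (φ A) := fun A =>
    (LipschitzWith.of_dist_le_mul (K := ⟨L, hL.le⟩) fun x y => hlip A x y).continuous
  refine le_of_forall_gt_imp_ge_of_dense fun b' hb' => ?_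
  obtain ⟨b, hb, hbb'⟩ := ENNReal.lt_iff_exists_nnreal_btwn.1 hb'
  refine le_trans ?_ hbb'.le
  obtain ⟨D, hD, hDb⟩ := ENNReal.lt_iff_exists_nnreal_btwn.1 hb
  have hDb' : (D : ℝ) < b := by exact_mod_cast hDb
  -- A scale `ε` so small that the gap between `D` and `b` absorbs the constants.
  have hsmall : ∀ᶠ ε : ℝ in 𝓝[>] 0, 0 < ε ∧ ε < 1 ∧ 6 * L * ε ≤ 1 ∧
      Fintype.card α * Real.log 2 + b * Real.log (6 * L) < (b - D) * -Real.log ε := by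
    have hpos : ∀ᶠ ε : ℝ in 𝓝[>] 0, 0 < ε := self_mem_nhdsWithin
    have hlt : ∀ c : ℝ, 0 < c → ∀ᶠ ε : ℝ in 𝓝[>] 0, ε < c := fun c hc =>
      mem_nhdsWithin_of_mem_nhds (Iio_mem_nhds hc)
    have hlog : Tendsto (fun ε : ℝ => (b - D) * -Real.log ε) (𝓝[>] 0) atTop :=
      (tendsto_neg_atBot_atTop.comp Real.tendsto_log_nhdsGT_zero).const_mul_atTop
        (sub_pos.2 hDb')
    filter_upwards [hpos, hlt 1 one_pos, hlt (6 * L)⁻¹ (by positivity),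
      hlog.eventually_gt_atTop _] with ε e1 e2 e3 e4
    refine ⟨e1, e2, ?_, e4⟩
    rw [lt_inv_comm₀ e1 (by positivity)] at e3
    calc 6 * L * ε ≤ ε⁻¹ * ε := by gcongr
      _ = 1 := inv_mul_cancel₀ e1.ne'
  obtain ⟨ε, hε, hε0, hε1, hεL, hεb⟩ := ((frequently_lt_of_liminf_lt (by isBoundedDefault)
    hD).and_eventually hsmall).exists
  have hlogε : 0 < -Real.log ε := neg_pos.2 (Real.log_neg hε0 hε1)
  rw [ENNReal.div_lt_iff (Or.inl (by simpa using hlogε)) (Or.inl ENNReal.ofReal_ne_top)] at hε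
  refine limsup_le_of_le (by isBoundedDefault) ?_
  filter_upwards [eventually_lt_of_limsup_lt hε (by isBoundedDefault), eventually_ge_atTop 1]
    with n hn hn1
  have hn0 : (0 : ℝ) < n := by exact_mod_cast hn1
  rw [ENNReal.div_lt_iff (Or.inl (by exact_mod_cast hn0.ne')) (Or.inl (ENNReal.natCast_ne_top n)),
    show (D : ℝ≥0∞) * ENNReal.ofReal (-Real.log ε) * (n : ℝ≥0∞)
      = ENNReal.ofReal (D * -Real.log ε * n) by
        rw [ENNReal.ofReal_mul (by positivity), ENNReal.ofReal_mul (by positivity),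
          ENNReal.ofReal_coe_nnreal, ENNReal.ofReal_natCast]] at hn
  obtain ⟨c, hc, hdiam, hcard⟩ := R.exists_finset_cover_of_log_cov_lt hn
  set a : ℝ := (6 * L * ε)⁻¹ with ha
  have ha1 : 1 ≤ a := (one_le_inv₀ (by positivity)).2 hεL
  have hloga : Real.log a = -Real.log (6 * L) - Real.log ε := by
    rw [ha, Real.log_inv, Real.log_mul (by positivity) hε0.ne']
    ring
  -- The grid with spacing `3 * (L * ε)` has about `2 * a` points in `[0, 1]`.
  set M : ℕ := ⌊2 * a⌋₊ with hM
  have haM : a ≤ M := by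
    have := Nat.lt_floor_add_one (2 * a)
    linarith
  set m : ℕ := ⌊(b : ℝ) * n⌋₊ with hm
  have hcount : c.card * 2 ^ Fintype.card (Fin n × α) < M ^ (m + 1) := by
    have hR : (c.card : ℝ) * 2 ^ Fintype.card (Fin n × α) < (M : ℝ) ^ (m + 1) :=
      calc (c.card : ℝ) * 2 ^ Fintype.card (Fin n × α)
          ≤ Real.exp (D * -Real.log ε * n) * Real.exp (n * Fintype.card α * Real.log 2) := by
            gcongr
            refine le_of_eq ?_
            rw [Fintype.card_prod, Fintype.card_fin, ← Nat.cast_mul, Real.exp_nat_mul,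
              Real.exp_log two_pos]
        _ = Real.exp (n * (D * -Real.log ε + Fintype.card α * Real.log 2)) := by
            rw [← Real.exp_add]
            congr 1
            ring
        _ < Real.exp (n * (b * Real.log a)) := by
            refine Real.exp_lt_exp.2 (mul_lt_mul_of_pos_left ?_ hn0)
            rw [hloga]
            linarith
        _ ≤ Real.exp ((m + 1 : ℕ) * Real.log a) := by
            refine Real.exp_le_exp.2 ?_
            rw [← mul_assoc]
            refine mul_le_mul_of_nonneg_right ?_ (Real.log_nonneg ha1)
            have := (Nat.lt_floor_add_one ((b : ℝ) * n)).le
            push_cast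
            rw [mul_comm]
            exact this
        _ = a ^ (m + 1) := by rw [Real.exp_nat_mul, Real.exp_log (by positivity)]
        _ ≤ (M : ℝ) ^ (m + 1) := by gcongr
    exact_mod_cast hR
  have hdim : coverDim (R.joinedCover α n ω) ≤ m := by
    refine coverDim_le_of_oscillation_le (J := Fin n × α)
      (f := fun j x => φ j.2 (R.iter j.1 ω x))
      (fun j => (hφ _).comp (continuous_subtype_val.comp (hω _))) hc (δ := L * ε) (by positivity)
      (fun A hA x hx y hy j => ?_) ?_ hcount
      fun W hW => R.exists_subset_of_mem_joinedCover h1 h0 hW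
    · refine (hlip _ _ _).trans ?_
      gcongr
      exact (R.dist_iter_lt_of_fiberDiam_lt_one hε0 (hdiam A hA) hx hy j.1).le
    · calc (M : ℝ) * (3 * (L * ε)) ≤ 2 * a * (3 * (L * ε)) := by
            gcongr
            exact Nat.floor_le (by positivity)
        _ = 1 := by
            rw [ha]
            field_simp
            norm_num
  refine ENNReal.div_le_of_le_mul ?_
  calc (coverDim (R.joinedCover α n ω) : ℝ≥0∞) ≤ ((m : ℕ∞) : ℝ≥0∞) :=
        ENat.toENNReal_le.2 hdim
    _ ≤ b * n := by
        rw [ENat.toENNReal_coe]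
        have : (m : NNReal) ≤ b * n := by
          have := Nat.floor_le (a := (b : ℝ) * n) (by positivity)
          exact_mod_cast this
        exact_mod_cast this

end Metric

end BundleRDS

/-! ### Integration over the base -/

theorem mainTheorem2 {Ω : Type*} [MeasurableSpace Ω] (P : Measure Ω) [IsProbabilityMeasure P]
    [P.IsComplete] {X : Type*} [MetricSpace X] [CompactSpace X] [MeasurableSpace X] [BorelSpace X]
    (T : BundleRDS P X) :
    T.mdim ≤ T.mdimM := by
  refine iSup₂_le fun α hα => ?_
  -- The reverse Fatou lemma is for measurable functions, so the integrands are replaced by measurable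
  -- minorants with the same (lower) integrals; measurability of `coverDim` is then not needed.
  choose g hgm hgle hgint using fun n : ℕ =>
    exists_measurable_le_lintegral_eq P fun ω => (coverDim (T.joinedCover α n ω) : ℝ≥0∞)
  have hbound : ∀ n : ℕ, (fun ω => g n ω / (n : ℝ≥0∞)) ≤ᵐ[P] fun _ => (α.ncard : ℝ≥0∞) := by
    intro n
    filter_upwards [T.ae_continuous_iter] with ω hω
    refine ENNReal.div_le_of_le_mul ((hgle n ω).trans ?_)
    refine (ENat.toENNReal_le.2 (T.coverDim_joinedCover_le hα hω n)).trans_eq ?_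
    rw [ENat.toENNReal_coe, Nat.cast_mul, mul_comm]
  calc T.mdimCover α
      = limsup (fun n : ℕ => ∫⁻ ω, g n ω / (n : ℝ≥0∞) ∂P) atTop := by
        refine congrArg (fun u : ℕ → ℝ≥0∞ => limsup u atTop) (funext fun n => ?_)
        simp only [div_eq_mul_inv]
        rw [lintegral_mul_const _ (hgm n), hgint n]
    _ ≤ ∫⁻ ω, limsup (fun n : ℕ => g n ω / (n : ℝ≥0∞)) atTop ∂P :=
        limsup_lintegral_le _ (fun n => (hgm n).div_const _) hbound (by simp)
    _ ≤ T.mdimM := by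
        refine lintegral_mono_ae ?_
        filter_upwards [T.ae_continuous_iter] with ω hω
        refine le_trans (limsup_le_limsup (Eventually.of_forall fun n => ?_))
          (T.limsup_coverDim_div_le_mdimMFiber hα hω)
        exact ENNReal.div_le_div_right (hgle n ω) _
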